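/- A $0,1$ matrix is a matrix of finite size $n\times m$ all of whose entries are $0$ or $1$. Its binary rank $R_{\mathrm{bin}}(M)$ is the minimal $d$ for which there exist $0,1$ matrices $A$ of size $n\times d$ and $B$ of size $d\times m$ with $M=A\cdot B$, where the operations are over the integers. A sub-matrix of $M$ is obtained by restricting $M$ to a set of rows and a set of columns (not necessarily consecutive); it is proper if it is not $M$ itself. Claim. (1) There is no $0,1$ matrix $M$ with binary rank $4$ such that each $4\times 4$ sub-matrix of $M$ has binary rank strictly smaller than $4$; that is, every $0,1$ matrix of binary rank $4$ has a $4\times4$ sub-matrix of binary rank $4$. (2) In particular, there is no $0,1$ matrix $M$ with binary rank $4$, of size other than $4\times 4$, such that each proper sub-matrix of $M$ has binary rank strictly smaller than $4$. -/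

import Mathlib

/-- A `0,1` matrix: an integer matrix all of whose entries are `0` or `1`. -/
def IsZeroOne {ι κ : Type*} (M : Matrix ι κ ℤ) : Prop :=
  ∀ i j, M i j = 0 ∨ M i j = 1

/-- `M = A * B` over the integers, where `A` and `B` are `0,1` matrices and `A` has `d` columns
(and `B` has `d` rows). -/
def HasBinaryDecomposition {ι κ : Type*} (M : Matrix ι κ ℤ) (d : ℕ) : Prop :=
  ∃ (A : Matrix ι (Fin d) ℤ) (B : Matrix (Fin d) κ ℤ),
    IsZeroOne A ∧ IsZeroOne B ∧ M = A * B

/-- The binary rank of a `0,1` matrix: the minimal `d` for which `M` is the product, over the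
integers, of `0,1` matrices `A` with `d` columns and `B` with `d` rows. -/
noncomputable def binaryRank {ι κ : Type*} (M : Matrix ι κ ℤ) : ℕ :=
  sInf {d : ℕ | HasBinaryDecomposition M d}

/-- The minimum in the definition of the binary rank is attained for every `0,1` matrix with
finitely many columns. -/
theorem IsZeroOne.hasBinaryDecomposition_binaryRank {ι κ : Type*} [Fintype κ]
    {M : Matrix ι κ ℤ} (hM : IsZeroOne M) : HasBinaryDecomposition M (binaryRank M) := by
  classical
  have hne : {d : ℕ | HasBinaryDecomposition M d}.Nonempty := by
    refine ⟨Fintype.card κ, Matrix.of fun i k => M i ((Fintype.equivFin κ).symm k),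
      Matrix.of fun k j => if (Fintype.equivFin κ).symm k = j then 1 else 0, ?_, ?_, ?_⟩
    · intro i k
      exact hM i _
    · intro k j
      simp only [Matrix.of_apply]
      split_ifs <;> simp
    · ext i j
      simp only [Matrix.mul_apply, Matrix.of_apply]
      rw [Equiv.sum_comp (Fintype.equivFin κ).symm
        (fun x => M i x * (if x = j then (1 : ℤ) else 0))]
      simp
  exact Nat.sInf_mem hne

/-- The sub-matrix of `M` induced by the rows in `R` and the columns in `C` (neither of which
need be consecutive). -/
def subMatrix {n m : ℕ} (M : Matrix (Fin n) (Fin m) ℤ) (R : Finset (Fin n))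
    (C : Finset (Fin m)) : Matrix {i // i ∈ R} {j // j ∈ C} ℤ :=
  M.submatrix Subtype.val Subtype.val

/-!
A `0,1` matrix `M` all of whose `4 × 4` submatrices have binary rank at most three has vanishing
minors of order four, and none of its `4 × 4` submatrices is the biadjacency matrix of the
eight-cycle, in which a perfect matching is a fooling set of size four. Such an `M` has binary rank
at most three (`IsZeroOne.exists_hasBinaryDecomposition_le_three`), for the following reasons.

If some minor of order three is neither `0` nor `±1`, its rows are the three vectors of weight two,
and a parity argument shows that `M` has at most three different nonzero rows or at most three
different nonzero columns (`IsZeroOne.hasBinaryDecomposition_three_of_det_notMem`).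

Otherwise let `k ≤ 3` be the largest order of a nonzero minor. By Cramer's rule the rows of `M` have
coefficients in `{-1, 0, 1}` with respect to any basis of `k` rows. Take a basis with as few ones as
possible. A row with a negative coefficient must have a positive one, being nonnegative; if it had
just one, it would have fewer ones than the corresponding basis row and could replace it
(`IsZeroOne.exists_light_row_basis`). So either all coefficients are `0` or `1`, and the basis is
the right factor of a decomposition, or `k = 3` and some row is `p + q - s`, where `p`, `q`, `s` are
the rows of the basis. In the latter case write `d` for that row, so that `p + q = s + d`, and
consider the columns with exactly two ones among these four rows; there is one of `p`, `q` and one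
of `s`, `d` in each. If all four kinds occur they form the eight-cycle; if one is missing, the
columns of `M` give a decomposition of size three
(`IsZeroOne.hasBinaryDecomposition_three_of_forall_not`).
-/

open Matrix

/-! ### Binary decompositions -/

lemma IsZeroOne.nonneg {ι κ : Type*} {M : Matrix ι κ ℤ} (hM : IsZeroOne M) (i : ι) (j : κ) :
    0 ≤ M i j := by
  rcases hM i j with h | h <;> simp [h]

lemma IsZeroOne.transpose {ι κ : Type*} {M : Matrix ι κ ℤ} (hM : IsZeroOne M) :
    IsZeroOne Mᵀ :=
  fun i j => hM j i

lemma HasBinaryDecomposition.transpose {ι κ : Type*} {M : Matrix ι κ ℤ} {d : ℕ}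
    (h : HasBinaryDecomposition M d) : HasBinaryDecomposition Mᵀ d := by
  obtain ⟨A, B, hA, hB, rfl⟩ := h
  exact ⟨Bᵀ, Aᵀ, hB.transpose, hA.transpose, transpose_mul A B⟩

lemma HasBinaryDecomposition.submatrix {ι κ ι' κ' : Type*} {M : Matrix ι κ ℤ} {d : ℕ}
    (h : HasBinaryDecomposition M d) (f : ι' → ι) (g : κ' → κ) :
    HasBinaryDecomposition (M.submatrix f g) d := by
  obtain ⟨A, B, hA, hB, rfl⟩ := h
  exact ⟨A.submatrix f id, B.submatrix id g, fun i t => hA _ _, fun t j => hB _ _, rfl⟩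

/-- A fooling set of size `s`: each of its ones needs its own term of a binary decomposition. -/
lemma HasBinaryDecomposition.le_of_fooling {ι κ : Type*} {M : Matrix ι κ ℤ} {d s : ℕ}
    (h : HasBinaryDecomposition M d) (f : Fin s → ι) (g : Fin s → κ)
    (hone : ∀ u, M (f u) (g u) = 1)
    (hzero : ∀ u v, u ≠ v → M (f u) (g v) = 0 ∨ M (f v) (g u) = 0) : s ≤ d := by
  obtain ⟨A, B, hA, hB, rfl⟩ := h
  have hex : ∀ u, ∃ t, A (f u) t * B t (g u) ≠ 0 := by
    intro u
    by_contra! hcon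
    have := hone u
    simp [mul_apply, hcon] at this
  choose t ht using hex
  have hno : ∀ u v, t u = t v → (A * B) (f u) (g v) ≠ 0 := by
    intro u v huv hz
    rw [mul_apply, Finset.sum_eq_zero_iff_of_nonneg
      fun k _ => mul_nonneg (hA.nonneg _ _) (hB.nonneg _ _)] at hz
    have h0 := hz (t u) (Finset.mem_univ _)
    rcases mul_eq_zero.1 h0 with h1 | h1
    · exact ht u (by simp [h1])
    · exact ht v (by rw [← huv]; simp [h1])
  have hinj : Function.Injective t := by
    intro u v huv
    by_contra hne
    rcases hzero u v hne with h0 | h0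
    · exact hno u v huv h0
    · exact hno v u huv.symm h0
  simpa using Fintype.card_le_of_injective t hinj

lemma HasBinaryDecomposition.le_of_det_ne_zero {s d : ℕ} {N : Matrix (Fin s) (Fin s) ℤ}
    (h : HasBinaryDecomposition N d) (hN : N.det ≠ 0) : s ≤ d := by
  obtain ⟨A, B, -, -, rfl⟩ := h
  have hrow : LinearIndependent ℤ (B.vecMulLinear ∘ A.row) :=
    linearIndependent_rows_of_det_ne_zero hN
  simpa using (LinearIndependent.of_comp _ hrow).fintype_card_le_finrank

/-- If, apart from zero columns, the columns of a `0,1` matrix fall into `d` classes of equal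
columns, then the binary rank is at most `d`. The classes are the fibres of the labelling `y`
over the labels `V t`; some of them may be empty. -/
lemma IsZeroOne.hasBinaryDecomposition_of_column_classes {ι κ σ : Type*} {M : Matrix ι κ ℤ}
    (hM : IsZeroOne M) {d : ℕ} (y : κ → σ) (V : Fin d → σ)
    (hV : ∀ j, (∀ i, M i j = 0) ∨ ∃ t, y j = V t)
    (hy : ∀ j j', y j = y j' → ∀ i, M i j = M i j') : HasBinaryDecomposition M d := by
  classical
  have hlab : ∀ j, ∃ o : Option (Fin d),
      (o = none → ∀ i, M i j = 0) ∧ ∀ t, o = some t → y j = V t := by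
    intro j
    rcases hV j with h | ⟨t, ht⟩
    · exact ⟨none, fun _ => h, by simp⟩
    · refine ⟨some t, by simp, ?_⟩
      rintro t' ⟨⟩
      exact ht
  choose o ho using hlab
  refine ⟨of fun i t => if h : ∃ j, o j = some t then M i h.choose else 0,
    of fun t j => if o j = some t then 1 else 0, ?_, ?_, ?_⟩
  · intro i t
    simp only [of_apply]
    split_ifs
    · exact hM _ _
    · exact Or.inl rfl
  · intro t j
    simp only [of_apply]
    split_ifs <;> simp
  · ext i j
    simp only [mul_apply, of_apply]
    rcases hoj : o j with _ | t
    · simp [(ho j).1 hoj i]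
    · have hex : ∃ j', o j' = some t := ⟨j, hoj⟩
      rw [Finset.sum_eq_single t]
      · rw [dif_pos hex, if_pos rfl, mul_one]
        refine hy _ _ ?_ i
        rw [(ho j).2 t hoj, (ho _).2 t hex.choose_spec]
      · intro t' _ hne
        rw [if_neg (by simpa using hne.symm), mul_zero]
      · simp

/-- The biadjacency matrix of the cycle of length eight. -/
def eightCycle : Matrix (Fin 4) (Fin 4) ℤ :=
  !![1, 1, 0, 0; 0, 0, 1, 1; 1, 0, 1, 0; 0, 1, 0, 1]

lemma four_le_of_hasBinaryDecomposition_eightCycle {d : ℕ}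
    (h : HasBinaryDecomposition eightCycle d) : 4 ≤ d := by
  -- a perfect matching of the cycle is a fooling set
  refine h.le_of_fooling (s := 4) id ![0, 3, 2, 1] (fun u => ?_) (fun u v huv => ?_)
  · fin_cases u <;> rfl
  · revert u v
    decide +kernel

/-! ### Minors of absolute value two -/

/-- A `0,1` matrix of order three whose determinant is not `0`, `1` or `-1` has the three vectors
of weight two as its rows, in some order. -/
lemma exists_row_eq_of_det_notMem (N : Matrix (Fin 3) (Fin 3) ℤ) (hN : IsZeroOne N)
    (hdet : N.det ∉ ({-1, 0, 1} : Set ℤ)) (u : Fin 3) :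
    ∃ s, ∀ v, N s v = if u = v then 0 else 1 := by
  have key : ∀ a b c d e f g h k : Bool,
      (a.toInt * e.toInt * k.toInt - a.toInt * f.toInt * h.toInt - b.toInt * d.toInt * k.toInt
        + b.toInt * f.toInt * g.toInt + c.toInt * d.toInt * h.toInt
        - c.toInt * e.toInt * g.toInt = -1 ∨
      a.toInt * e.toInt * k.toInt - a.toInt * f.toInt * h.toInt - b.toInt * d.toInt * k.toInt
        + b.toInt * f.toInt * g.toInt + c.toInt * d.toInt * h.toInt
        - c.toInt * e.toInt * g.toInt = 0 ∨
      a.toInt * e.toInt * k.toInt - a.toInt * f.toInt * h.toInt - b.toInt * d.toInt * k.toInt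
        + b.toInt * f.toInt * g.toInt + c.toInt * d.toInt * h.toInt
        - c.toInt * e.toInt * g.toInt = 1) ∨
      ∀ u, ∃ s, ∀ v, (![![a, b, c], ![d, e, f], ![g, h, k]] : Fin 3 → Fin 3 → Bool) s v
        = decide (u ≠ v) := by
    decide +kernel
  have hB : ∀ i j, ∃ b : Bool, N i j = b.toInt := by
    intro i j
    rcases hN i j with h | h
    · exact ⟨false, h⟩
    · exact ⟨true, h⟩
  choose b hb using hB
  rw [det_fin_three] at hdet
  simp only [hb] at hdet
  rcases key (b 0 0) (b 0 1) (b 0 2) (b 1 0) (b 1 1) (b 1 2) (b 2 0) (b 2 1) (b 2 2) with h | h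
  · exact absurd h hdet
  · obtain ⟨s, hs⟩ := h u
    refine ⟨s, fun v => ?_⟩
    have hbs : b s v = decide (u ≠ v) := by
      rw [← hs v]
      fin_cases s <;> fin_cases v <;> rfl
    rw [hb, hbs]
    by_cases huv : u = v <;> simp [huv]

/-- When all minors of order four vanish, a minor of order three of absolute value two leaves at
most three nonzero rows or at most three nonzero columns, up to repetition: with `X i` and `Y j`
the weights of the row `i` and the column `j` next to that minor, `X i * Y j` is always even. -/
lemma IsZeroOne.hasBinaryDecomposition_three_of_det_notMem {ι κ : Type*} {M : Matrix ι κ ℤ}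
    (hM : IsZeroOne M)
    (h4 : ∀ (r : Fin 4 → ι) (c : Fin 4 → κ), (M.submatrix r c).det = 0)
    (r₀ : Fin 3 → ι) (c : Fin 3 → κ)
    (hdet : (M.submatrix r₀ c).det ∉ ({-1, 0, 1} : Set ℤ)) : HasBinaryDecomposition M 3 := by
  choose s hs using exists_row_eq_of_det_notMem (M.submatrix r₀ c) (fun i j => hM _ _) hdet
  set r : Fin 3 → ι := r₀ ∘ s
  have hN : ∀ u v, M (r u) (c v) = if u = v then 0 else 1 := hs
  have hform : ∀ i j, 2 * M i j =
      (M i (c 0) + M i (c 1) + M i (c 2)) * (M (r 0) j + M (r 1) j + M (r 2) j)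
        - 2 * (M i (c 0) * M (r 0) j + M i (c 1) * M (r 1) j + M i (c 2) * M (r 2) j) := by
    intro i j
    have h := h4 ![i, r 0, r 1, r 2] ![j, c 0, c 1, c 2]
    have hmat : M.submatrix ![i, r 0, r 1, r 2] ![j, c 0, c 1, c 2] =
        !![M i j, M i (c 0), M i (c 1), M i (c 2); M (r 0) j, 0, 1, 1;
          M (r 1) j, 1, 0, 1; M (r 2) j, 1, 1, 0] := by
      ext u v
      fin_cases u <;> fin_cases v <;> simp [hN]
    rw [hmat] at h
    simp [det_succ_row_zero, Fin.sum_univ_succ, Fin.succAbove] at h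
    linarith
  have hparity : (∀ j, Even (M (r 0) j + M (r 1) j + M (r 2) j)) ∨
      ∀ i, Even (M i (c 0) + M i (c 1) + M i (c 2)) := by
    by_contra! hcon
    obtain ⟨⟨j, hj⟩, ⟨i, hi⟩⟩ := hcon
    have hodd := (Int.not_even_iff_odd.1 hi).mul (Int.not_even_iff_odd.1 hj)
    rw [← Int.not_even_iff_odd] at hodd
    exact hodd ⟨M i j + (M i (c 0) * M (r 0) j + M i (c 1) * M (r 1) j + M i (c 2) * M (r 2) j),
      by linarith [hform i j]⟩
  let V : Fin 3 → ℤ × ℤ × ℤ := ![(0, 1, 1), (1, 0, 1), (1, 1, 0)]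
  -- the vectors of even weight are zero and the three vectors of weight two
  have heven : ∀ a b c : ℤ, (a = 0 ∨ a = 1) → (b = 0 ∨ b = 1) → (c = 0 ∨ c = 1) →
      Even (a + b + c) → (a = 0 ∧ b = 0 ∧ c = 0) ∨
        ∃ t, (a, b, c) = V t := by
    rintro a b c (rfl | rfl) (rfl | rfl) (rfl | rfl) <;> decide
  rcases hparity with hY | hX
  · refine hM.hasBinaryDecomposition_of_column_classes
      (fun j => (M (r 0) j, M (r 1) j, M (r 2) j)) V (fun j => ?_) ?_
    · refine (heven _ _ _ (hM _ _) (hM _ _) (hM _ _) (hY j)).imp_left ?_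
      rintro ⟨h0, h1, h2⟩ i
      have := hform i j
      simpa [h0, h1, h2] using this
    · intro j j' hjj i
      simp only [Prod.mk.injEq] at hjj
      obtain ⟨h0, h1, h2⟩ := hjj
      have e := hform i j
      have e' := hform i j'
      rw [h0, h1, h2] at e
      linarith
  · refine (hM.transpose.hasBinaryDecomposition_of_column_classes
      (fun i => (M i (c 0), M i (c 1), M i (c 2))) V (fun i => ?_) ?_).transpose
    · refine (heven _ _ _ (hM _ _) (hM _ _) (hM _ _) (hX i)).imp_left ?_
      rintro ⟨h0, h1, h2⟩ j
      have := hform i j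
      simpa [h0, h1, h2] using this
    · intro i i' hii j
      simp only [Prod.mk.injEq] at hii
      obtain ⟨h0, h1, h2⟩ := hii
      have e := hform i j
      have e' := hform i' j
      rw [h0, h1, h2] at e
      simp only [transpose_apply]
      linarith

/-! ### Row bases of minimal weight -/

/-- A unimodular minor of maximal order gives a row basis over the integers. -/
lemma exists_row_coefficients {ι κ : Type*} {M : Matrix ι κ ℤ} {k : ℕ}
    (hk : ∀ (r : Fin (k + 1) → ι) (c : Fin (k + 1) → κ), (M.submatrix r c).det = 0)
    (r : Fin k → ι) (c : Fin k → κ) (hdet : IsUnit (M.submatrix r c).det) (i : ι) :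
    ∃ α : Fin k → ℤ, ∀ j, M i j = ∑ t, α t * M (r t) j := by
  set N := M.submatrix r c with hNdef
  have hN : IsUnit N := (isUnit_iff_isUnit_det N).2 hdet
  let := hN.invertible
  refine ⟨(fun t => M i (c t)) ᵥ* ⅟N, fun j => ?_⟩
  -- the Schur complement of `N` in the minor bordered by the row `i` and the column `j` vanishes
  have hbord : (fromBlocks N (of fun t (_ : Fin 1) => M (r t) j)
      (of fun (_ : Fin 1) t => M i (c t)) (of fun _ _ => M i j)).det = 0 := by
    have h := hk (Sum.elim r (fun _ => i) ∘ finSumFinEquiv.symm)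
      (Sum.elim c (fun _ => j) ∘ finSumFinEquiv.symm)
    rw [← submatrix_submatrix, det_submatrix_equiv_self] at h
    rw [← h]
    congr 1
    ext (u | u) (v | v) <;> rfl
  rw [det_fromBlocks₁₁, hdet.mul_right_eq_zero, det_unique] at hbord
  simp only [Matrix.sub_apply, of_apply, mul_apply] at hbord
  simp only [vecMul, dotProduct]
  linarith

lemma det_submatrix_update {ι κ : Type*} {M : Matrix ι κ ℤ} {k : ℕ}
    (r : Fin k → ι) (c : Fin k → κ) {i : ι} {α : Fin k → ℤ}
    (hα : ∀ j, M i j = ∑ t, α t * M (r t) j) (t : Fin k) :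
    (M.submatrix (Function.update r t i) c).det = α t * (M.submatrix r c).det := by
  rw [← smul_eq_mul, ← det_updateRow_sum (M.submatrix r c) t α]
  congr 1
  ext u v
  rcases eq_or_ne u t with rfl | hu
  · simp [hα, Finset.sum_apply]
  · simp [hu, updateRow_ne]

/-- If the nonzero minors of maximal order `k` are `1` and `-1`, there is a basis of `k` rows with
integer coefficients such that each row either is the sum of a subset of the basis or has two
coefficients `1` and a coefficient `-1`. The basis is one of least weight: a row with a negative
coefficient and just one positive coefficient would be lighter than the corresponding basis row,
which it could replace, and a row with no positive coefficient would have negative weight. -/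
lemma IsZeroOne.exists_light_row_basis {ι κ : Type*} [Finite ι] [Fintype κ]
    {M : Matrix ι κ ℤ} (hM : IsZeroOne M) {k : ℕ}
    (hk : ∀ (r : Fin (k + 1) → ι) (c : Fin (k + 1) → κ), (M.submatrix r c).det = 0)
    (hne : ∃ (r : Fin k → ι) (c : Fin k → κ), (M.submatrix r c).det ≠ 0)
    (hdet : ∀ (r : Fin k → ι) (c : Fin k → κ),
      (M.submatrix r c).det ∈ ({-1, 0, 1} : Set ℤ)) :
    ∃ (r : Fin k → ι) (α : ι → Fin k → ℤ), (∀ i j, M i j = ∑ t, α i t * M (r t) j) ∧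
      ∀ i, (∀ t, α i t = 0 ∨ α i t = 1) ∨
        ∃ p q s, p ≠ q ∧ p ≠ s ∧ q ≠ s ∧ α i p = 1 ∧ α i q = 1 ∧ α i s = -1 := by
  classical
  let w : ι → ℤ := fun i => ∑ j, M i j
  obtain ⟨r, ⟨c, hrc⟩, hmin⟩ := Set.exists_min_image
    {r : Fin k → ι | ∃ c : Fin k → κ, (M.submatrix r c).det ≠ 0} (fun r => ∑ t, w (r t))
    (Set.toFinite _) hne
  have hunit : (M.submatrix r c).det = 1 ∨ (M.submatrix r c).det = -1 := by
    rcases hdet r c with h | h | h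
    · exact Or.inr h
    · exact absurd h hrc
    · exact Or.inl h
  choose α hα using exists_row_coefficients hk r c (Int.isUnit_iff.2 hunit)
  have hcoef : ∀ i t, α i t = -1 ∨ α i t = 0 ∨ α i t = 1 := by
    intro i t
    have h := hdet (Function.update r t i) c
    rw [det_submatrix_update r c (hα i) t] at h
    rcases hunit with hu | hu <;> rw [hu] at h <;>
      simp only [Set.mem_insert_iff, Set.mem_singleton_iff] at h <;> lia
  refine ⟨r, α, hα, fun i => ?_⟩
  by_contra! hcon
  obtain ⟨⟨s, hs0, hs1⟩, hno⟩ := hcon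
  have hs : α i s = -1 := by
    rcases hcoef i s with h | h | h
    · exact h
    · exact absurd h hs0
    · exact absurd h hs1
  have hw0 : ∀ i, 0 ≤ w i := fun i => Finset.sum_nonneg fun j _ => hM.nonneg i j
  have hws : 0 < w (r s) := by
    refine lt_of_le_of_ne (hw0 _) fun h0 => hrc ?_
    refine det_eq_zero_of_row_eq_zero s fun t => ?_
    exact (Finset.sum_eq_zero_iff_of_nonneg fun j _ => hM.nonneg (r s) j).1 h0.symm (c t)
      (Finset.mem_univ _)
  have hwi : w i = ∑ t, α i t * w (r t) := by
    simp only [w, hα i, Finset.mul_sum]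
    exact Finset.sum_comm
  have hreplace : ∀ p, α i p = 1 → w (r p) ≤ w i := by
    intro p hp
    have h := hmin (Function.update r p i) ⟨c, by
      rw [det_submatrix_update r c (hα i) p, hp, one_mul]
      exact hrc⟩
    have e1 := Finset.add_sum_erase Finset.univ (fun t => w (r t)) (Finset.mem_univ p)
    have e2 := Finset.add_sum_erase Finset.univ (fun t => w (Function.update r p i t))
      (Finset.mem_univ p)
    have e3 : ∑ t ∈ Finset.univ.erase p, w (Function.update r p i t) =
        ∑ t ∈ Finset.univ.erase p, w (r t) :=
      Finset.sum_congr rfl fun t ht => by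
        rw [Function.update_of_ne (Finset.ne_of_mem_erase ht)]
    simp only [Function.update_self] at e2
    linarith
  rw [← Finset.add_sum_erase Finset.univ _ (Finset.mem_univ s), hs] at hwi
  by_cases hp : ∃ p, α i p = 1
  · obtain ⟨p, hp⟩ := hp
    have hps : p ≠ s := by
      rintro rfl
      lia
    rw [← Finset.add_sum_erase _ _ (Finset.mem_erase.2 ⟨hps, Finset.mem_univ p⟩), hp] at hwi
    have hrest : ∑ t ∈ (Finset.univ.erase s).erase p, α i t * w (r t) ≤ 0 := by
      refine Finset.sum_nonpos fun t ht => ?_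
      simp only [Finset.mem_erase, Finset.mem_univ, and_true] at ht
      refine mul_nonpos_of_nonpos_of_nonneg ?_ (hw0 _)
      rcases hcoef i t with h | h | h
      · lia
      · lia
      · exact absurd hs (hno p t s (Ne.symm ht.1) hps ht.2 hp h)
    linarith [hreplace p hp]
  · push Not at hp
    have hrest : ∑ t ∈ Finset.univ.erase s, α i t * w (r t) ≤ 0 := by
      refine Finset.sum_nonpos fun t _ => mul_nonpos_of_nonpos_of_nonneg ?_ (hw0 _)
      rcases hcoef i t with h | h | h
      · lia
      · lia
      · exact absurd h (hp t)
    linarith [hw0 i]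

/-! ### Row relations and column bases -/

/-- Let `M a + M b = M c + M d` and let the rows `a`, `b`, `c` span the row space. The nonzero
columns of the four rows are the all-ones column and the four columns with a one in one of
`a`, `b` and a one in one of `c`, `d`. If the one with ones in `a` and `c` does not occur, there
is a binary decomposition of size three: either the columns with ones in `a` and `d`, in `b` and
`c`, and in `b` and `d` all occur and form a column basis, or at most three kinds are left. -/
lemma IsZeroOne.hasBinaryDecomposition_three_of_forall_not {ι κ : Type*} {M : Matrix ι κ ℤ}
    (hM : IsZeroOne M) (a b c d : ι) (habcd : ∀ j, M a j + M b j = M c j + M d j)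
    (hspan : ∀ i, ∃ α β γ : ℤ, ∀ j, M i j = α * M a j + β * M b j + γ * M c j)
    (hmiss : ∀ j, ¬ (M a j = 1 ∧ M b j = 0 ∧ M c j = 1 ∧ M d j = 0)) :
    HasBinaryDecomposition M 3 := by
  choose α β γ hspan using hspan
  have htype : ∀ j, (M a j = 0 ∧ M b j = 0 ∧ M c j = 0) ∨ (M a j = 1 ∧ M b j = 1 ∧ M c j = 1) ∨
      (M a j = 1 ∧ M b j = 0 ∧ M c j = 0) ∨ (M a j = 0 ∧ M b j = 1 ∧ M c j = 1) ∨
      (M a j = 0 ∧ M b j = 1 ∧ M c j = 0) := by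
    intro j
    have := habcd j
    have := hmiss j
    rcases hM a j with _ | _ <;> rcases hM b j with _ | _ <;> rcases hM c j with _ | _ <;>
      rcases hM d j with _ | _ <;> lia
  have hclasses : ∀ V : Fin 3 → ℤ × ℤ × ℤ,
      (∀ j, (M a j = 0 ∧ M b j = 0 ∧ M c j = 0) ∨ ∃ t, (M a j, M b j, M c j) = V t) →
      HasBinaryDecomposition M 3 := by
    intro V hV
    refine hM.hasBinaryDecomposition_of_column_classes (fun j => (M a j, M b j, M c j)) V
      (fun j => (hV j).imp_left ?_) ?_
    · rintro ⟨h0, h1, h2⟩ i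
      rw [hspan i j, h0, h1, h2]
      simp
    · intro j j' hjj i
      simp only [Prod.mk.injEq] at hjj
      rw [hspan i j, hspan i j', hjj.1, hjj.2.1, hjj.2.2]
  by_cases h1 : ∃ j, M a j = 1 ∧ M b j = 0 ∧ M c j = 0
  swap
  · refine hclasses ![(1, 1, 1), (0, 1, 1), (0, 1, 0)] fun j => ?_
    simp only [Fin.exists_fin_succ, Prod.ext_iff]
    simp
    have := htype j
    have := fun h => h1 ⟨j, h⟩
    tauto
  by_cases h2 : ∃ j, M a j = 0 ∧ M b j = 1 ∧ M c j = 1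
  swap
  · refine hclasses ![(1, 1, 1), (1, 0, 0), (0, 1, 0)] fun j => ?_
    simp only [Fin.exists_fin_succ, Prod.ext_iff]
    simp
    have := htype j
    have := fun h => h2 ⟨j, h⟩
    tauto
  by_cases h3 : ∃ j, M a j = 0 ∧ M b j = 1 ∧ M c j = 0
  swap
  · refine hclasses ![(1, 1, 1), (1, 0, 0), (0, 1, 1)] fun j => ?_
    simp only [Fin.exists_fin_succ, Prod.ext_iff]
    simp
    have := htype j
    have := fun h => h3 ⟨j, h⟩
    tauto
  obtain ⟨j₁, ha₁, hb₁, hc₁⟩ := h1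
  obtain ⟨j₂, ha₂, hb₂, hc₂⟩ := h2
  obtain ⟨j₃, ha₃, hb₃, hc₃⟩ := h3
  -- the column `j` is `M a j` times `j₁` plus `M c j` times `j₂` plus `M b j - M c j` times `j₃`
  refine ⟨of fun i t => M i (![j₁, j₂, j₃] t), of ![M a, M c, M b - M c],
    fun i t => hM _ _, fun t j => ?_, ?_⟩
  · fin_cases t
    · exact hM a j
    · exact hM c j
    · have := htype j
      simp only [of_apply]
      change M b j - M c j = 0 ∨ M b j - M c j = 1
      lia
  · ext i j
    simp [mul_apply, Fin.sum_univ_succ, hspan i j, hspan i j₁, hspan i j₂, hspan i j₃, ha₁,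
      hb₁, hc₁, ha₂, hb₂, hc₂, ha₃, hb₃, hc₃]
    ring

/-- A `0,1` matrix with vanishing minors of order four and with no submatrix equal to the
biadjacency matrix of the cycle of length eight has binary rank at most three. -/
lemma IsZeroOne.exists_hasBinaryDecomposition_le_three {ι κ : Type*} [Finite ι] [Fintype κ]
    {M : Matrix ι κ ℤ} (hM : IsZeroOne M)
    (h4 : ∀ (r : Fin 4 → ι) (c : Fin 4 → κ), (M.submatrix r c).det = 0)
    (hcyc : ∀ (r : Fin 4 → ι) (c : Fin 4 → κ), M.submatrix r c ≠ eightCycle) :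
    ∃ d ≤ 3, HasBinaryDecomposition M d := by
  by_cases h2 : ∃ (r : Fin 3 → ι) (c : Fin 3 → κ),
      (M.submatrix r c).det ∉ ({-1, 0, 1} : Set ℤ)
  · obtain ⟨r, c, h⟩ := h2
    exact ⟨3, le_rfl, hM.hasBinaryDecomposition_three_of_det_notMem h4 r c h⟩
  push Not at h2
  -- the largest order `k` of a nonzero minor
  obtain ⟨k, hk3, hne, hk⟩ : ∃ k ≤ 3,
      (∃ (r : Fin k → ι) (c : Fin k → κ), (M.submatrix r c).det ≠ 0) ∧
      ∀ (r : Fin (k + 1) → ι) (c : Fin (k + 1) → κ), (M.submatrix r c).det = 0 := by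
    by_contra! hcon
    have h0 : ∃ (r : Fin 0 → ι) (c : Fin 0 → κ), (M.submatrix r c).det ≠ 0 :=
      ⟨Fin.elim0, Fin.elim0, by simp⟩
    obtain ⟨r, c, h⟩ := hcon 3 le_rfl (hcon 2 (by simp) (hcon 1 (by simp) (hcon 0 (by simp) h0)))
    exact h (h4 r c)
  have hdet : ∀ (r : Fin k → ι) (c : Fin k → κ),
      (M.submatrix r c).det ∈ ({-1, 0, 1} : Set ℤ) := by
    intro r c
    interval_cases k
    · simp
    · rcases hM (r 0) (c 0) with h | h <;> simp [h]
    · rcases hM (r 0) (c 0) with h | h <;> rcases hM (r 0) (c 1) with h' | h' <;>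
        rcases hM (r 1) (c 0) with h'' | h'' <;> rcases hM (r 1) (c 1) with h''' | h''' <;>
        simp [det_fin_two, h, h', h'', h''']
    · exact h2 r c
  obtain ⟨r, α, hα, hbasis⟩ := hM.exists_light_row_basis hk hne hdet
  by_cases hall : ∀ i t, α i t = 0 ∨ α i t = 1
  · refine ⟨k, hk3, of α, M.submatrix r id, hall, fun t j => hM _ _, ?_⟩
    ext i j
    rw [hα i j, mul_apply]
    rfl
  push Not at hall
  obtain ⟨d, u, hu0, hu1⟩ := hall
  rcases hbasis d with h | ⟨p, q, s, hpq, hps, hqs, hp, hq, hs⟩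
  · exact absurd (h u) (by simp [hu0, hu1])
  have huniv : ∀ f : Fin k → ℤ, ∑ t, f t = f p + f q + f s := by
    have : (Finset.univ : Finset (Fin k)) = {p, q, s} := by
      refine (Finset.eq_of_subset_of_card_le (Finset.subset_univ _) ?_).symm
      rw [Finset.card_eq_three.2 ⟨p, q, s, hpq, hps, hqs, rfl⟩]
      simpa using hk3
    intro f
    rw [this, Finset.sum_insert (by simp [hpq, hps]), Finset.sum_pair hqs, add_assoc]
  have hrel : ∀ j, M (r p) j + M (r q) j = M (r s) j + M d j := by
    intro j
    rw [hα d j, huniv, hp, hq, hs]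
    ring
  have hspan : ∀ i j, M i j = α i p * M (r p) j + α i q * M (r q) j + α i s * M (r s) j :=
    fun i j => by rw [hα i j, huniv]
  refine ⟨3, le_rfl, ?_⟩
  by_contra hno
  -- all four kinds of mixed columns occur
  obtain ⟨j₁, h₁⟩ : ∃ j, M (r p) j = 1 ∧ M (r q) j = 0 ∧ M (r s) j = 1 ∧ M d j = 0 := by
    by_contra! h
    exact hno (hM.hasBinaryDecomposition_three_of_forall_not _ _ _ _ hrel
      (fun i => ⟨_, _, _, hspan i⟩) fun j hj => h j hj.1 hj.2.1 hj.2.2.1 hj.2.2.2)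
  obtain ⟨j₂, h₂⟩ : ∃ j, M (r p) j = 1 ∧ M (r q) j = 0 ∧ M d j = 1 ∧ M (r s) j = 0 := by
    by_contra! h
    refine hno (hM.hasBinaryDecomposition_three_of_forall_not (r p) (r q) d (r s)
      (fun j => by rw [hrel, add_comm])
      (fun i => ⟨α i p + α i s, α i q + α i s, -α i s, fun j => ?_⟩)
      fun j hj => h j hj.1 hj.2.1 hj.2.2.1 hj.2.2.2)
    linear_combination hspan i j - α i s * hrel j
  obtain ⟨j₃, h₃⟩ : ∃ j, M (r q) j = 1 ∧ M (r p) j = 0 ∧ M (r s) j = 1 ∧ M d j = 0 := by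
    by_contra! h
    refine hno (hM.hasBinaryDecomposition_three_of_forall_not (r q) (r p) (r s) d
      (fun j => by rw [← hrel, add_comm])
      (fun i => ⟨α i q, α i p, α i s, fun j => ?_⟩)
      fun j hj => h j hj.1 hj.2.1 hj.2.2.1 hj.2.2.2)
    linear_combination hspan i j
  obtain ⟨j₄, h₄⟩ : ∃ j, M (r q) j = 1 ∧ M (r p) j = 0 ∧ M d j = 1 ∧ M (r s) j = 0 := by
    by_contra! h
    refine hno (hM.hasBinaryDecomposition_three_of_forall_not (r q) (r p) d (r s)
      (fun j => by rw [add_comm, hrel, add_comm])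
      (fun i => ⟨α i q + α i s, α i p + α i s, -α i s, fun j => ?_⟩)
      fun j hj => h j hj.1 hj.2.1 hj.2.2.1 hj.2.2.2)
    linear_combination hspan i j - α i s * hrel j
  refine hcyc ![r p, r q, r s, d] ![j₁, j₂, j₃, j₄] ?_
  ext u v
  fin_cases u <;> fin_cases v <;> simp [eightCycle, h₁, h₂, h₃, h₄]

/-! ### Reduction of the rank to submatrices of order four -/

lemma exists_hasBinaryDecomposition_submatrix_lt_four {n m : ℕ} {M : Matrix (Fin n) (Fin m) ℤ}
    (hM : IsZeroOne M)
    (hsub : ∀ (R : Finset (Fin n)) (C : Finset (Fin m)), R.card = 4 → C.card = 4 →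
      binaryRank (subMatrix M R C) < 4)
    {r : Fin 4 → Fin n} {c : Fin 4 → Fin m} (hr : Function.Injective r)
    (hc : Function.Injective c) : ∃ d < 4, HasBinaryDecomposition (M.submatrix r c) d := by
  have hlt := hsub (Finset.univ.image r) (Finset.univ.image c)
    (by simp [Finset.card_image_of_injective _ hr])
    (by simp [Finset.card_image_of_injective _ hc])
  have hzo : IsZeroOne (subMatrix M (Finset.univ.image r) (Finset.univ.image c)) :=
    fun i j => hM _ _
  exact ⟨_, hlt, hzo.hasBinaryDecomposition_binaryRank.submatrix
    (fun u => ⟨r u, by simp⟩) (fun v => ⟨c v, by simp⟩)⟩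

lemma exists_subMatrix_binaryRank_ge_four {n m : ℕ} {M : Matrix (Fin n) (Fin m) ℤ}
    (hM : IsZeroOne M) (h4 : binaryRank M = 4) :
    ∃ (R : Finset (Fin n)) (C : Finset (Fin m)), R.card = 4 ∧ C.card = 4 ∧
      4 ≤ binaryRank (subMatrix M R C) := by
  by_contra! hsub
  have hdet : ∀ (r : Fin 4 → Fin n) (c : Fin 4 → Fin m), (M.submatrix r c).det = 0 := by
    intro r c
    by_contra hdet
    have hr : Function.Injective r := fun u v huv => by
      by_contra hne
      exact hdet (det_zero_of_row_eq hne (by ext j; simp [huv]))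
    have hc : Function.Injective c := fun u v huv => by
      by_contra hne
      exact hdet (det_zero_of_column_eq hne (by intro i; simp [huv]))
    obtain ⟨d, hd4, hd⟩ := exists_hasBinaryDecomposition_submatrix_lt_four hM hsub hr hc
    exact absurd (hd.le_of_det_ne_zero hdet) (by lia)
  have hcyc : ∀ (r : Fin 4 → Fin n) (c : Fin 4 → Fin m), M.submatrix r c ≠ eightCycle := by
    intro r c h
    have hW : ∀ u v, M (r u) (c v) = eightCycle u v := fun u v => by rw [← h]; rfl
    have hr : Function.Injective r := by
      intro u v huv
      have hrow : ∀ u v, eightCycle u 0 = eightCycle v 0 → eightCycle u 1 = eightCycle v 1 →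
          u = v := by
        decide +kernel
      exact hrow u v (by rw [← hW, ← hW, huv]) (by rw [← hW, ← hW, huv])
    have hc : Function.Injective c := by
      intro u v huv
      have hcol : ∀ u v, (∀ i, eightCycle i u = eightCycle i v) → u = v := by decide +kernel
      exact hcol u v fun i => by rw [← hW, ← hW, huv]
    obtain ⟨d, hd4, hd⟩ := exists_hasBinaryDecomposition_submatrix_lt_four hM hsub hr hc
    rw [h] at hd
    exact absurd (four_le_of_hasBinaryDecomposition_eightCycle hd) (by lia)
  obtain ⟨d, hd3, hd⟩ := hM.exists_hasBinaryDecomposition_le_three hdet hcyc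
  have : binaryRank M ≤ d := Nat.sInf_le hd
  lia

theorem mainTheorem6 :
    (¬ ∃ (n m : ℕ) (M : Matrix (Fin n) (Fin m) ℤ),
        IsZeroOne M ∧ binaryRank M = 4 ∧
          ∀ (R : Finset (Fin n)) (C : Finset (Fin m)), R.card = 4 → C.card = 4 →
            binaryRank (subMatrix M R C) < 4) ∧
    (¬ ∃ (n m : ℕ) (M : Matrix (Fin n) (Fin m) ℤ),
        ¬ (n = 4 ∧ m = 4) ∧ IsZeroOne M ∧ binaryRank M = 4 ∧
          ∀ (R : Finset (Fin n)) (C : Finset (Fin m)), ¬ (R = Finset.univ ∧ C = Finset.univ) →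
            binaryRank (subMatrix M R C) < 4) := by
  constructor
  · rintro ⟨n, m, M, hM, h4, hsub⟩
    obtain ⟨R, C, hR, hC, h⟩ := exists_subMatrix_binaryRank_ge_four hM h4
    exact absurd (hsub R C hR hC) (not_lt.2 h)
  · rintro ⟨n, m, M, hsize, hM, h4, hsub⟩
    obtain ⟨R, C, hR, hC, h⟩ := exists_subMatrix_binaryRank_ge_four hM h4
    refine absurd (hsub R C ?_) (not_lt.2 h)
    rintro ⟨rfl, rfl⟩
    exact hsize ⟨by simpa using hR, by simpa using hC⟩
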